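/- Let $C[0,1]$ be the Banach space of continuous complex-valued functions on $[0,1]$ with the supremum norm, let $\overline{B}$ be its closed unit ball, and let $H$ be the group of all composition operators $f\mapsto f\circ\varphi$ on $C[0,1]$, where $\varphi:[0,1]\to[0,1]$ is a homeomorphism. A continuous polynomial on $C[0,1]$ is a function $P:C[0,1]\to\mathbb{C}$ of the form $P(f)=\sum_{k=0}^{n}A_k(f,\dots,f)$ with $n\ge 0$ and each $A_k$ a continuous $k$-linear form on $C[0,1]$; it is $H$-invariant if $P(\gamma(f))=P(f)$ for all $f\in C[0,1]$ and $\gamma\in H$. Let $g\in C[0,1]\setminus\overline{B}$. Then there exists an $H$-invariant continuous polynomial $P$ on $C[0,1]$ that separates $g$ from $\overline{B}$, that is, \[ \sup_{f\in\overline{B}}|P(f)|<|P(g)|, \] if and only if $\max\{|g(0)|,|g(1)|\}>1$. -/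

import Mathlib

open scoped unitInterval

/-- `P : E → F` is a continuous polynomial between normed spaces over `𝕜`: a finite sum
`P x = A₀ + A₁ x + A₂ (x, x) + ⋯ + Aₙ (x, …, x)`, where each `Aₖ` is a continuous `k`-linear map. -/
def IsContinuousPolynomial (𝕜 : Type*) {E F : Type*} [NontriviallyNormedField 𝕜]
    [NormedAddCommGroup E] [NormedSpace 𝕜 E] [NormedAddCommGroup F] [NormedSpace 𝕜 F]
    (P : E → F) : Prop :=
  ∃ (n : ℕ) (A : (k : ℕ) → ContinuousMultilinearMap 𝕜 (fun _ : Fin k => E) F),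
    ∀ x : E, P x = ∑ k ∈ Finset.range (n + 1), A k (fun _ => x)

/-- `P` is invariant under the group `G` of bounded linear automorphisms of `E`. -/
def IsGroupInvariant {𝕜 E F : Type*} [NontriviallyNormedField 𝕜]
    [NormedAddCommGroup E] [NormedSpace 𝕜 E] (G : Subgroup (E ≃L[𝕜] E)) (P : E → F) : Prop :=
  ∀ γ ∈ G, ∀ x : E, P (γ x) = P x

/-- `P` separates the point `z` and the set `K`: `sup_{w ∈ K} |P w| < |P z|`. The supremum is taken
in `[0, ∞]`, so it is the honest supremum even if `P` is unbounded on `K`. -/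
def SeparatesPointFromSet {E F : Type*} [NormedAddCommGroup F] (P : E → F) (z : E) (K : Set E) :
    Prop :=
  (⨆ w ∈ K, ‖P w‖ₑ) < ‖P z‖ₑ

/-- The group `H` of composition operators `f ↦ f ∘ φ` on the complex Banach space `C(K)`,
where `φ` runs over the homeomorphisms of the compact space `K`. -/
def compositionGroup (K : Type*) [TopologicalSpace K] [CompactSpace K] :
    Subgroup (C(K, ℂ) ≃L[ℂ] C(K, ℂ)) where
  carrier := {γ | ∃ φ : K ≃ₜ K, ∀ f : C(K, ℂ), γ f = f.comp (φ : C(K, K))}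
  one_mem' := ⟨Homeomorph.refl K, fun _ => rfl⟩
  mul_mem' := by
    rintro γ₁ γ₂ ⟨φ₁, h₁⟩ ⟨φ₂, h₂⟩
    refine ⟨φ₁.trans φ₂, fun f => ?_⟩
    change γ₁ (γ₂ f) = _
    rw [h₂, h₁]
    rfl
  inv_mem' := by
    rintro γ ⟨φ, h⟩
    refine ⟨φ.symm, fun f => ?_⟩
    change γ.symm f = _
    rw [ContinuousLinearEquiv.symm_apply_eq, h]
    ext x
    simp

/-- Every homeomorphism `φ` of `K` does give a member of the group of composition operators. -/
theorem exists_mem_compositionGroup {K : Type*} [TopologicalSpace K] [CompactSpace K]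
    (φ : K ≃ₜ K) : ∃ γ ∈ compositionGroup K, ∀ f : C(K, ℂ), γ f = f.comp (φ : C(K, K)) := by
  let γ : C(K, ℂ) ≃L[ℂ] C(K, ℂ) :=
    { toFun := fun f => f.comp (φ : C(K, K))
      invFun := fun f => f.comp (φ.symm : C(K, K))
      map_add' := fun _ _ => rfl
      map_smul' := fun _ _ => rfl
      left_inv := fun f => by ext x; simp
      right_inv := fun f => by ext x; simp
      continuous_toFun := ContinuousMap.continuous_precomp _
      continuous_invFun := ContinuousMap.continuous_precomp _ }
  exact ⟨γ, ⟨φ, fun _ => rfl⟩, fun _ => rfl⟩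

/-! An invariant polynomial sees only the two endpoint values (`apply_eq_of_eq_endpoints`). If both
have modulus at most 1, the affine function with the same endpoints lies in the ball, so nothing
separates; otherwise a symmetric polynomial in `f 0`, `f 1` does.

The reduction rests on a Bessel inequality: a polynomial bounded on all unimodular combinations of
directions `D i` cannot change by a fixed amount along infinitely many of them. If `φ` fixes `f` and
moves a bump `d` to disjoint translates, these have bounded sums and by invariance all change `P`
equally, so `P (f + d) = P f`. Such bumps can be added wherever `f` is constant on an interval, and
this suffices to join `u` to `v`. -/

/-! ### Mean values over roots of unity -/

theorem Polynomial.sum_eval_pow_of_natDegree_lt {m : ℕ} {ω : ℂ} (hω : IsPrimitiveRoot ω m)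
    {p : Polynomial ℂ} (hp : p.natDegree < m) :
    ∑ k ∈ Finset.range m, p.eval (ω ^ k) = m * p.eval 0 := by
  have key : ∀ j ∈ Finset.range m, ∑ k ∈ Finset.range m, p.coeff j * (ω ^ k) ^ j =
      if j = 0 then m * p.coeff 0 else 0 := by
    intro j hj
    rw [← Finset.mul_sum]
    split_ifs with h
    · subst h
      simp [mul_comm]
    · have h1 : ω ^ j ≠ 1 := hω.pow_ne_one_of_pos_of_lt h (Finset.mem_range.1 hj)
      have h2 : ∑ k ∈ Finset.range m, (ω ^ k) ^ j = 0 := by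
        have h3 : ∀ k ∈ Finset.range m, (ω ^ k) ^ j = (ω ^ j) ^ k := fun k _ => by
          rw [← pow_mul, ← pow_mul, mul_comm]
        rw [Finset.sum_congr rfl h3, geom_sum_eq h1, ← pow_mul, mul_comm, pow_mul, hω.pow_eq_one]
        simp
      rw [h2, mul_zero]
  simp_rw [Polynomial.eval_eq_sum_range' hp (ω ^ _)]
  rw [Finset.sum_comm, Finset.sum_congr rfl key, Finset.sum_ite_eq' (Finset.range m) 0,
    if_pos (Finset.mem_range.2 (by omega)), Polynomial.coeff_zero_eq_eval_zero]

theorem ContinuousMultilinearMap.exists_polynomial_line {E : Type*} [NormedAddCommGroup E]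
    [NormedSpace ℂ E] {k : ℕ} (A : ContinuousMultilinearMap ℂ (fun _ : Fin k => E) ℂ) (x y : E) :
    ∃ p : Polynomial ℂ, p.natDegree ≤ k ∧ ∀ z : ℂ, A (fun _ => x + z • y) = p.eval z := by
  classical
  refine ⟨∑ s : Finset (Fin k), Polynomial.monomial s.card
    (A (s.piecewise (fun _ => y) (fun _ => x))), ?_, fun z => ?_⟩
  · refine Polynomial.natDegree_sum_le_of_forall_le _ _ fun s _ => ?_
    exact (Polynomial.natDegree_monomial_le _).trans (by simpa using Finset.card_le_univ s)
  · have h : (fun _ : Fin k => x + z • y) = (fun _ => z • y) + (fun _ => x) := by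
      ext; simp [add_comm]
    rw [h, A.map_add_univ, Polynomial.eval_finsetSum]
    refine Finset.sum_congr rfl fun s _ => ?_
    have h2 : s.piecewise (fun _ : Fin k => z • y) (fun _ => x) =
        s.piecewise (fun i => (fun _ : Fin k => z) i • s.piecewise (fun _ : Fin k => y)
          (fun _ => x) i) (s.piecewise (fun _ : Fin k => y) (fun _ => x)) := by
      ext i
      by_cases hi : i ∈ s <;> simp [hi]
    rw [h2, A.map_piecewise_smul]
    simp [mul_comm]

namespace IsContinuousPolynomial

variable {E : Type*} [NormedAddCommGroup E] [NormedSpace ℂ E] {P : E → ℂ}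

theorem exists_rootsOfUnity_mean (hP : IsContinuousPolynomial ℂ P) :
    ∃ (m : ℕ) (ω : ℂ), 0 < m ∧ ‖ω‖ = 1 ∧
      ∀ x y : E, ∑ k ∈ Finset.range m, P (x + ω ^ k • y) = m * P x := by
  obtain ⟨n, A, hA⟩ := hP
  have hω := Complex.isPrimitiveRoot_exp (n + 1) (by omega)
  refine ⟨n + 1, _, by omega, hω.norm'_eq_one (by omega), fun x y => ?_⟩
  choose p hp hp' using fun k => (A k).exists_polynomial_line x y
  have h : ∀ z : ℂ, P (x + z • y) = (∑ k ∈ Finset.range (n + 1), p k).eval z := fun z => by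
    rw [hA, Polynomial.eval_finsetSum]
    exact Finset.sum_congr rfl fun k _ => hp' k z
  have hd : (∑ k ∈ Finset.range (n + 1), p k).natDegree < n + 1 := by
    refine Nat.lt_succ_of_le (Polynomial.natDegree_sum_le_of_forall_le _ _ fun k hk => ?_)
    exact (hp k).trans (Nat.lt_succ_iff.1 (Finset.mem_range.1 hk))
  have h0 : P x = (∑ k ∈ Finset.range (n + 1), p k).eval 0 := by simpa using h 0
  simp_rw [h]
  rw [Polynomial.sum_eval_pow_of_natDegree_lt hω hd, h0]

theorem continuous (hP : IsContinuousPolynomial ℂ P) : Continuous P := by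
  obtain ⟨n, A, hA⟩ := hP
  rw [funext hA]
  exact continuous_finsetSum _ fun k _ => (A k).cont.comp (continuous_pi fun _ => continuous_id)

theorem exists_norm_le_of_norm_le (hP : IsContinuousPolynomial ℂ P) (R : ℝ) :
    ∃ M : ℝ, ∀ x : E, ‖x‖ ≤ R → ‖P x‖ ≤ M := by
  obtain ⟨n, A, hA⟩ := hP
  refine ⟨∑ k ∈ Finset.range (n + 1), ‖A k‖ * R ^ k, fun x hx => ?_⟩
  rw [hA]
  refine norm_sum_le_of_le _ fun k _ => ?_
  refine ((A k).le_opNorm _).trans ?_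
  simp only [Finset.prod_const, Finset.card_univ, Fintype.card_fin]
  gcongr

end IsContinuousPolynomial

/-! ### The Bessel inequality and its consequence -/

/-- The variance identity: deviations from the mean are orthogonal to constants. -/
theorem sum_norm_sq_eq_of_sum_eq {m : ℕ} {a : ℕ → ℂ} {c : ℂ}
    (h : ∑ k ∈ Finset.range m, a k = m * c) :
    ∑ k ∈ Finset.range m, ‖a k‖ ^ 2 =
      m * ‖c‖ ^ 2 + ∑ k ∈ Finset.range m, ‖a k - c‖ ^ 2 := by
  have h1 : ∀ k, ‖a k‖ ^ 2 = ‖c‖ ^ 2 + ‖a k - c‖ ^ 2 +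
      2 * (c.re * (a k).re + c.im * (a k).im - c.re ^ 2 - c.im ^ 2) := fun k => by
    simp only [Complex.sq_norm, Complex.normSq_apply, Complex.sub_re, Complex.sub_im]
    ring
  have hr := congrArg Complex.re h
  have hi := congrArg Complex.im h
  simp only [Complex.re_sum, Complex.im_sum, Complex.mul_re, Complex.mul_im, Complex.natCast_re,
    Complex.natCast_im, zero_mul, sub_zero, add_zero] at hr hi
  simp_rw [h1]
  simp only [Finset.sum_add_distrib, ← Finset.mul_sum, Finset.sum_sub_distrib, Finset.sum_const,
    Finset.card_range, nsmul_eq_mul, hr, hi]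
  ring

/-- A Bessel inequality for functions with the mean value property over roots of unity. -/
theorem bessel_of_rootsOfUnity_mean {E ι : Type*} [AddCommGroup E] [Module ℂ E]
    {P : E → ℂ} {m : ℕ} {ω : ℂ} (hm : 0 < m) (hω : ‖ω‖ = 1)
    (hP : ∀ x y : E, ∑ k ∈ Finset.range m, P (x + ω ^ k • y) = m * P x)
    (y : ι → E) (C : ℝ) (s : Finset ι) : ∀ x : E,
    (∀ z : ι → ℂ, (∀ i, ‖z i‖ = 1) → ‖P (x + ∑ i ∈ s, z i • y i)‖ ^ 2 ≤ C) →
    m * ‖P x‖ ^ 2 + ∑ i ∈ s, ∑ k ∈ Finset.range m, ‖P (x + ω ^ k • y i) - P x‖ ^ 2 ≤ m * C := by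
  classical
  induction s using Finset.induction_on with
  | empty =>
    intro x h
    have := h (fun _ => 1) (by simp)
    simp only [Finset.sum_empty, add_zero] at this ⊢
    gcongr
  | insert a t ha ih =>
    intro x h
    -- The induction hypothesis is used at each base point `x + ω ^ l • y a`, then summed over `l`;
    -- averaging brings the base point back to `x` and can only decrease the squares (`h3`).
    have h1 : ∀ l ∈ Finset.range m, m * ‖P (x + ω ^ l • y a)‖ ^ 2 + ∑ i ∈ t,
        ∑ k ∈ Finset.range m, ‖P (x + ω ^ l • y a + ω ^ k • y i) - P (x + ω ^ l • y a)‖ ^ 2 ≤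
        m * C := fun l _ => by
      refine ih _ fun z hz => ?_
      convert h (Function.update z a (ω ^ l)) (fun i => ?_) using 4
      · rw [Finset.sum_insert ha, add_assoc]
        congr 1
        simp only [Function.update_self]
        congr 1
        refine Finset.sum_congr rfl fun i hi => ?_
        rw [Function.update_of_ne (ne_of_mem_of_not_mem hi ha)]
      · by_cases hi : i = a
        · subst hi; simp [hω]
        · simp [hi, hz]
    have h2 := Finset.sum_le_sum h1
    rw [Finset.sum_add_distrib, ← Finset.mul_sum, sum_norm_sq_eq_of_sum_eq (hP x (y a)),
      Finset.sum_comm] at h2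
    have h3 : ∀ i ∈ t, m * ∑ k ∈ Finset.range m, ‖P (x + ω ^ k • y i) - P x‖ ^ 2 ≤
        ∑ l ∈ Finset.range m, ∑ k ∈ Finset.range m,
          ‖P (x + ω ^ l • y a + ω ^ k • y i) - P (x + ω ^ l • y a)‖ ^ 2 := fun i _ => by
      rw [Finset.sum_comm, Finset.mul_sum]
      refine Finset.sum_le_sum fun k _ => ?_
      have h4 : ∑ l ∈ Finset.range m, (P (x + ω ^ l • y a + ω ^ k • y i) -
          P (x + ω ^ l • y a)) = m * (P (x + ω ^ k • y i) - P x) := by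
        rw [Finset.sum_sub_distrib, hP, mul_sub, ← hP (x + ω ^ k • y i) (y a)]
        simp only [add_right_comm]
      rw [sum_norm_sq_eq_of_sum_eq h4]
      exact le_add_of_nonneg_right (Finset.sum_nonneg fun _ _ => by positivity)
    have h5 := Finset.sum_le_sum h3
    rw [← Finset.mul_sum] at h5
    rw [Finset.sum_insert ha]
    simp only [Finset.sum_const, Finset.card_range, nsmul_eq_mul] at h2
    have hm' : (0 : ℝ) < m := by exact_mod_cast hm
    refine le_of_mul_le_mul_left ?_ hm'
    linarith

theorem IsContinuousPolynomial.eq_of_bounded_sums {E : Type*} [NormedAddCommGroup E]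
    [NormedSpace ℂ E] {P : E → ℂ} (hP : IsContinuousPolynomial ℂ P) (x : E) (D : ℕ → E) (R : ℝ)
    (hD : ∀ (N : ℕ) (z : ℕ → ℂ), (∀ i, ‖z i‖ = 1) → ‖∑ i ∈ Finset.range N, z i • D i‖ ≤ R)
    (hDP : ∀ (i : ℕ) (w : ℂ), P (x + w • D i) = P (x + w • D 0)) : P (x + D 0) = P x := by
  obtain ⟨m, ω, hm, hω, hmean⟩ := hP.exists_rootsOfUnity_mean
  obtain ⟨M, hM⟩ := hP.exists_norm_le_of_norm_le (‖x‖ + R)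
  have key : ∀ N : ℕ, N * ‖P (x + D 0) - P x‖ ^ 2 ≤ m * M ^ 2 := fun N => by
    have h := bessel_of_rootsOfUnity_mean hm hω hmean D (M ^ 2) (Finset.range N) x
      (fun z hz => by
        gcongr
        exact hM _ ((norm_add_le _ _).trans (add_le_add_right (hD N z hz) _)))
    refine le_trans ?_ h
    refine le_trans ?_ (le_add_of_nonneg_left (by positivity))
    rw [← nsmul_eq_mul]
    conv_lhs => rw [← Finset.card_range N]
    refine Finset.card_nsmul_le_sum _ _ _ fun i _ => ?_
    -- Only the term `k = 0`, where `ω ^ 0 = 1`, is kept.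
    refine le_trans ?_ (Finset.single_le_sum (fun _ _ => by positivity) (Finset.mem_range.2 hm))
    rw [hDP]
    simp
  by_contra hne
  have hpos : 0 < ‖P (x + D 0) - P x‖ ^ 2 := by
    have := norm_pos_iff.2 (sub_ne_zero.2 hne)
    positivity
  obtain ⟨N, hN⟩ := exists_nat_gt (m * M ^ 2 / ‖P (x + D 0) - P x‖ ^ 2)
  rw [div_lt_iff₀ hpos] at hN
  exact absurd (key N) (not_le.2 hN)

/-! ### Invariance and wandering bumps -/

theorem IsGroupInvariant.apply_comp_homeomorph {K : Type*} [TopologicalSpace K] [CompactSpace K]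
    {P : C(K, ℂ) → ℂ} (hG : IsGroupInvariant (compositionGroup K) P) (φ : K ≃ₜ K) (f : C(K, ℂ)) :
    P (f.comp (φ : C(K, K))) = P f := by
  obtain ⟨γ, hγ, h⟩ := exists_mem_compositionGroup φ
  rw [← h, hG γ hγ]

theorem ContinuousMap.norm_sum_le_of_pairwise_disjoint {K ι : Type*} [TopologicalSpace K]
    [CompactSpace K] {D : ι → C(K, ℂ)} {R : ℝ} (hR : 0 ≤ R) (hDR : ∀ i t, ‖D i t‖ ≤ R)
    (hD : ∀ i j t, i ≠ j → D i t ≠ 0 → D j t = 0) (s : Finset ι) (z : ι → ℂ)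
    (hz : ∀ i, ‖z i‖ = 1) : ‖∑ i ∈ s, z i • D i‖ ≤ R := by
  rw [ContinuousMap.norm_le _ hR]
  intro t
  rw [ContinuousMap.sum_apply]
  by_cases h : ∃ i ∈ s, D i t ≠ 0
  · obtain ⟨i, hi, hit⟩ := h
    rw [Finset.sum_eq_single_of_mem i hi fun j _ hj => by
      simp [hD i j t hj.symm hit]]
    simpa [hz] using hDR i t
  · push Not at h
    rw [Finset.sum_eq_zero fun i hi => by simp [h i hi]]
    simpa using hR

/-- Adding a bump whose translates under a symmetry `φ` of `f` are disjoint does not change the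
value of an invariant polynomial. -/
theorem IsContinuousPolynomial.apply_add_of_wandering {K : Type*} [TopologicalSpace K]
    [CompactSpace K] {P : C(K, ℂ) → ℂ} (hP : IsContinuousPolynomial ℂ P)
    (hG : IsGroupInvariant (compositionGroup K) P) (φ : K ≃ₜ K) {f d : C(K, ℂ)}
    (hf : ∀ t, f (φ t) = f t)
    (hd : ∀ i j t, i < j → d (φ^[i] t) ≠ 0 → d (φ^[j] t) = 0) : P (f + d) = P f := by
  let D : ℕ → C(K, ℂ) := fun i => d.comp ⟨φ^[i], φ.continuous.iterate i⟩
  have hD : ∀ i t, D i t = d (φ^[i] t) := fun _ _ => rfl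
  have hD0 : D 0 = d := by ext t; simp [hD]
  have hdisj : ∀ i j t, i ≠ j → D i t ≠ 0 → D j t = 0 := fun i j t hij h => by
    rcases lt_or_gt_of_ne hij with hij | hij
    · exact hd i j t hij h
    · by_contra h'
      exact h (hd j i t hij h')
  have hDP : ∀ (i : ℕ) (w : ℂ), P (f + w • D i) = P (f + w • D 0) := fun i w => by
    induction i with
    | zero => rfl
    | succ i ih =>
      rw [← ih, ← hG.apply_comp_homeomorph φ (f + w • D i)]
      congr 1
      ext t
      change f t + w * d (φ^[i + 1] t) = f (φ t) + w * d (φ^[i] (φ t))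
      rw [hf, Function.iterate_succ_apply]
  have hDR : ∀ i t, ‖D i t‖ ≤ ‖d‖ := fun i t => d.norm_coe_le_norm _
  have h := hP.eq_of_bounded_sums f D ‖d‖ (fun N z hz =>
    ContinuousMap.norm_sum_le_of_pairwise_disjoint (norm_nonneg _) hDR hdisj _ z hz) hDP
  rwa [hD0] at h

/-! ### Homeomorphisms of the interval -/

namespace unitInterval

theorem exists_homeomorph_of_strictMono (ψ : C(I, I)) (hψ : StrictMono ψ) (h0 : ψ 0 = 0)
    (h1 : ψ 1 = 1) : ∃ e : I ≃ₜ I, ∀ t, e t = ψ t :=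
  ⟨(hψ.orderIsoOfSurjective ψ fun _ => mem_range_of_exists_le_of_exists_ge ψ.continuous
    ⟨0, h0.symm ▸ unitInterval.nonneg'⟩ ⟨1, h1.symm ▸ unitInterval.le_one'⟩).toHomeomorph, fun _ => rfl⟩

/-- A homeomorphism of the unit interval which is the identity on `[5/7, 1]` and pushes the
interval `[1/7, 4/7]` off itself. -/
theorem exists_homeomorph_push : ∃ e : I ≃ₜ I, (∀ t, t ≤ e t) ∧
    (∀ t : I, 5 / 7 ≤ (t : ℝ) → e t = t) ∧ (∀ t : I, (t : ℝ) ≤ 5 / 7 → (e t : ℝ) ≤ 5 / 7) ∧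
    (∀ t : I, 1 / 7 ≤ (t : ℝ) → 4 / 7 ≤ (e t : ℝ)) := by
  -- The graph is piecewise linear through (0, 0), (1/7, 4/7), (5/7, 5/7), then the diagonal.
  let ψ : C(I, I) := ⟨fun t => ⟨max (t : ℝ) (min (4 * t) (t / 4 + 15 / 28)), by
    have := t.2.1
    have := t.2.2
    refine ⟨le_max_of_le_left t.2.1, max_le t.2.2 ?_⟩
    exact (min_le_right _ _).trans (by linarith)⟩, by fun_prop⟩
  have hv : ∀ t, (ψ t : ℝ) = max (t : ℝ) (min (4 * t) (t / 4 + 15 / 28)) := fun _ => rfl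
  have hmono : StrictMono ψ := fun s t hst => by
    have hst' : (s : ℝ) < t := hst
    rw [← Subtype.coe_lt_coe, hv, hv]
    exact max_lt_max hst' (min_lt_min (by linarith) (by linarith))
  obtain ⟨e, he⟩ := exists_homeomorph_of_strictMono ψ hmono
    (by ext; rw [hv]; norm_num) (by ext; rw [hv]; norm_num)
  have hev : ∀ t, (e t : ℝ) = max (t : ℝ) (min (4 * t) (t / 4 + 15 / 28)) := fun t => by
    rw [he, hv]
  refine ⟨e, fun t => ?_, fun t ht => ?_, fun t ht => ?_, fun t ht => ?_⟩
  · rw [← Subtype.coe_le_coe, hev]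
    exact le_max_left _ _
  · ext
    rw [hev]
    exact max_eq_left ((min_le_right _ _).trans (by linarith))
  · rw [hev]
    exact max_le ht ((min_le_right _ _).trans (by linarith))
  · rw [hev]
    exact le_max_of_le_right (le_min (by linarith) (by linarith))

/-- A monotone surjection of the unit interval is a uniform limit of homeomorphisms. -/
theorem exists_tendsto_homeomorph (κ : C(I, I)) (hκ : Monotone κ) (h0 : κ 0 = 0) (h1 : κ 1 = 1) :
    ∃ e : ℕ → (I ≃ₜ I), Filter.Tendsto (fun n => (e n : C(I, I))) Filter.atTop (nhds κ) := by
  have hmem : ∀ (n : ℕ) (t : I), (κ t : ℝ) + (t - κ t) * (1 / ((n : ℝ) + 1)) ∈ I := fun n t => by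
    have ha : (0 : ℝ) ≤ 1 / ((n : ℝ) + 1) := by positivity
    have hb : 1 / ((n : ℝ) + 1) ≤ 1 := by
      rw [div_le_one (by positivity)]
      linarith [(Nat.cast_nonneg n : (0 : ℝ) ≤ n)]
    have h := convex_Icc (0 : ℝ) 1 (κ t).2 t.2 (sub_nonneg.2 hb) ha (by ring)
    simp only [smul_eq_mul] at h
    convert h using 1
    ring
  -- Mixing in the identity with weight `1 / (n + 1)` makes `κ` strictly increasing.
  let ψ : ℕ → C(I, I) := fun n => ⟨fun t => ⟨_, hmem n t⟩, by fun_prop⟩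
  have hv : ∀ n t, (ψ n t : ℝ) = (κ t : ℝ) + (t - κ t) * (1 / ((n : ℝ) + 1)) := fun _ _ => rfl
  have hmono : ∀ n, StrictMono (ψ n) := fun n s t hst => by
    have hst' : (s : ℝ) < t := hst
    have hk : (κ s : ℝ) ≤ κ t := hκ hst.le
    have ha : (0 : ℝ) < 1 / ((n : ℝ) + 1) := by positivity
    have hb : 1 / ((n : ℝ) + 1) ≤ 1 := by
      rw [div_le_one (by positivity)]
      linarith [(Nat.cast_nonneg n : (0 : ℝ) ≤ n)]
    rw [← Subtype.coe_lt_coe, hv, hv]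
    nlinarith [mul_nonneg (sub_nonneg.2 hk) (sub_nonneg.2 hb), mul_pos (sub_pos.2 hst') ha]
  choose e he using fun n => exists_homeomorph_of_strictMono (ψ n) (hmono n)
    (by ext; rw [hv, h0]; norm_num) (by ext; rw [hv, h1]; norm_num)
  refine ⟨e, ?_⟩
  have hlim := tendsto_one_div_add_atTop_nhds_zero_nat (𝕜 := ℝ)
  rw [tendsto_iff_dist_tendsto_zero]
  refine squeeze_zero (fun _ => dist_nonneg) (fun n => ?_) hlim
  have ha : (0 : ℝ) ≤ 1 / ((n : ℝ) + 1) := by positivity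
  rw [ContinuousMap.dist_le ha]
  intro t
  have : ((e n : C(I, I)) t) = ψ n t := he n t
  rw [this, Subtype.dist_eq, hv, Real.dist_eq, add_sub_cancel_left, abs_mul, abs_of_nonneg ha]
  refine mul_le_of_le_one_left ha (abs_le.2 ⟨?_, ?_⟩)
  · linarith [t.2.1, (κ t).2.2]
  · linarith [t.2.2, (κ t).2.1]

end unitInterval

/-! ### Reduction to endpoint values -/

theorem IsContinuousPolynomial.apply_comp_of_monotone {P : C(I, ℂ) → ℂ}
    (hP : IsContinuousPolynomial ℂ P) (hG : IsGroupInvariant (compositionGroup I) P)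
    (u : C(I, ℂ)) (κ : C(I, I))
    (hκ : Monotone κ) (h0 : κ 0 = 0) (h1 : κ 1 = 1) : P (u.comp κ) = P u := by
  obtain ⟨e, he⟩ := unitInterval.exists_tendsto_homeomorph κ hκ h0 h1
  have h := (hP.continuous.tendsto _).comp ((ContinuousMap.continuous_postcomp u).tendsto κ |>.comp he)
  refine tendsto_nhds_unique h ?_
  refine tendsto_const_nhds.congr fun n => ?_
  exact (hG.apply_comp_homeomorph (e n) u).symm

theorem IsContinuousPolynomial.apply_add_of_flat_left {P : C(I, ℂ) → ℂ}
    (hP : IsContinuousPolynomial ℂ P) (hG : IsGroupInvariant (compositionGroup I) P)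
    {f d : C(I, ℂ)} {α : ℂ}
    (hf : ∀ t : I, (t : ℝ) ≤ 5 / 7 → f t = α)
    (hd : ∀ t : I, (t : ℝ) ≤ 1 / 7 ∨ 4 / 7 ≤ (t : ℝ) → d t = 0) : P (f + d) = P f := by
  obtain ⟨e, hle, hfix, hmaps, hpush⟩ := unitInterval.exists_homeomorph_push
  refine hP.apply_add_of_wandering hG e (fun t => ?_) fun i j t hij h => ?_
  · rcases le_total (t : ℝ) (5 / 7) with ht | ht
    · rw [hf _ (hmaps t ht), hf t ht]
    · rw [hfix t ht]
  · have h1 : 1 / 7 ≤ ((e^[i] t : I) : ℝ) := by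
      by_contra! h1
      exact h (hd _ (Or.inl h1.le))
    refine hd _ (Or.inr ((hpush _ h1).trans ?_))
    rw [← Function.iterate_succ_apply' e]
    exact Function.monotone_iterate_of_id_le hle (Nat.succ_le_of_lt hij) t

theorem IsContinuousPolynomial.apply_add_of_flat_right {P : C(I, ℂ) → ℂ}
    (hP : IsContinuousPolynomial ℂ P) (hG : IsGroupInvariant (compositionGroup I) P)
    {f d : C(I, ℂ)} {β : ℂ}
    (hf : ∀ t : I, 2 / 7 ≤ (t : ℝ) → f t = β)
    (hd : ∀ t : I, (t : ℝ) ≤ 3 / 7 ∨ 6 / 7 ≤ (t : ℝ) → d t = 0) : P (f + d) = P f := by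
  have h := hP.apply_add_of_flat_left hG
    (f := f.comp (unitInterval.symmHomeomorph : C(I, I)))
    (d := d.comp (unitInterval.symmHomeomorph : C(I, I))) (α := β)
    (fun t ht => hf _ (by
      change 2 / 7 ≤ 1 - (t : ℝ)
      linarith))
    (fun t ht => hd _ (by
      change 1 - (t : ℝ) ≤ 3 / 7 ∨ 6 / 7 ≤ 1 - (t : ℝ)
      rcases ht with ht | ht
      · right; linarith
      · left; linarith))
  rwa [← ContinuousMap.add_comp, hG.apply_comp_homeomorph, hG.apply_comp_homeomorph] at h

/-- An invariant continuous polynomial depends only on the values at the end points. -/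
theorem IsContinuousPolynomial.apply_eq_of_eq_endpoints {P : C(I, ℂ) → ℂ}
    (hP : IsContinuousPolynomial ℂ P) (hG : IsGroupInvariant (compositionGroup I) P)
    {u v : C(I, ℂ)} (h0 : u 0 = v 0)
    (h1 : u 1 = v 1) : P u = P v := by
  -- `κ c` climbs on `[c/7, (c+1)/7]`, `ρ` descends on `[3/7, 4/7]`. The common function reached
  -- below runs through `u`, then `u` backwards, then `v`; the constant removes the overlap. It
  -- differs from `u.comp (κ 1)` and from `v.comp (κ 5)` by a bump where each is flat.
  let κ : ℝ → C(I, I) := fun c => ⟨fun t => Set.projIcc 0 1 zero_le_one (7 * t - c), by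
    exact continuous_projIcc.comp (by fun_prop)⟩
  let ρ : C(I, I) := ⟨fun t => Set.projIcc 0 1 zero_le_one (4 - 7 * t), by
    exact continuous_projIcc.comp (by fun_prop)⟩
  have hκmono : ∀ c, Monotone (κ c) := fun c s t hst =>
    Set.monotone_projIcc zero_le_one (by linarith [show (s : ℝ) ≤ t from hst])
  have hκ0 : ∀ c (t : I), 7 * (t : ℝ) ≤ c → κ c t = 0 := fun c t h =>
    Set.projIcc_of_le_left zero_le_one (by linarith)
  have hκ1 : ∀ c (t : I), c + 1 ≤ 7 * (t : ℝ) → κ c t = 1 := fun c t h =>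
    Set.projIcc_of_right_le zero_le_one (by linarith)
  have hρ1 : ∀ t : I, (t : ℝ) ≤ 3 / 7 → ρ t = 1 := fun t h =>
    Set.projIcc_of_right_le zero_le_one (by linarith)
  have hρ0 : ∀ t : I, 4 / 7 ≤ (t : ℝ) → ρ t = 0 := fun t h =>
    Set.projIcc_of_le_left zero_le_one (by linarith)
  have hstretch : ∀ c, 0 ≤ c → c ≤ 6 → ∀ w : C(I, ℂ), P (w.comp (κ c)) = P w :=
    fun c hc hc' w => hP.apply_comp_of_monotone hG w (κ c) (hκmono c)
      (hκ0 c 0 (by simpa using hc)) (hκ1 c 1 (by simp; linarith))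
  have hu : P (u.comp (κ 1) + (u.comp ρ + v.comp (κ 5) - ContinuousMap.const I (u 1 + u 0))) =
      P (u.comp (κ 1)) := by
    refine hP.apply_add_of_flat_right hG (β := u 1) (fun t ht => ?_) fun t ht => ?_
    · simp [hκ1 1 t (by linarith)]
    · rcases ht with ht | ht
      · simp [hρ1 t ht, hκ0 5 t (by linarith), h0]
      · simp [hρ0 t (by linarith), hκ1 5 t (by linarith), ← h1, add_comm]
  have hv : P (v.comp (κ 5) + (u.comp (κ 1) + u.comp ρ - ContinuousMap.const I (u 1 + u 0))) =
      P (v.comp (κ 5)) := by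
    refine hP.apply_add_of_flat_left hG (α := v 0) (fun t ht => ?_) fun t ht => ?_
    · simp [hκ0 5 t (by linarith)]
    · rcases ht with ht | ht
      · simp [hρ1 t (by linarith), hκ0 1 t (by linarith), add_comm]
      · simp [hρ0 t ht, hκ1 1 t (by linarith)]
  rw [← hstretch 1 (by norm_num) (by norm_num) u, ← hstretch 5 (by norm_num) (by norm_num) v,
    ← hu, ← hv]
  congr 1
  abel

/-! ### Separating polynomials -/

theorem isContinuousPolynomial_apply_const {E : Type*} [NormedAddCommGroup E] [NormedSpace ℂ E]
    {n : ℕ} (A : ContinuousMultilinearMap ℂ (fun _ : Fin n => E) ℂ) :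
    IsContinuousPolynomial ℂ fun x => A fun _ => x := by
  refine ⟨n, fun k => if h : n = k then h ▸ A else 0, fun x => ?_⟩
  rw [Finset.sum_eq_single_of_mem n (Finset.self_mem_range_succ n) fun k _ hk => by
    simp [hk.symm]]
  simp

theorem isContinuousPolynomial_pow_add_pow (n : ℕ) :
    IsContinuousPolynomial ℂ fun f : C(I, ℂ) => f 0 ^ n + f 1 ^ n := by
  let A : I → ContinuousMultilinearMap ℂ (fun _ : Fin n => C(I, ℂ)) ℂ := fun t =>
    (ContinuousMultilinearMap.mkPiAlgebraFin ℂ n ℂ).compContinuousLinearMap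
      fun _ => ContinuousMap.evalCLM ℂ t
  have h : (fun f : C(I, ℂ) => f 0 ^ n + f 1 ^ n) = fun f => (A 0 + A 1) fun _ => f := by
    ext f
    simp [A, List.ofFn_const]
  rw [h]
  exact isContinuousPolynomial_apply_const _

theorem isContinuousPolynomial_mul :
    IsContinuousPolynomial ℂ fun f : C(I, ℂ) => f 0 * f 1 := by
  let A : ContinuousMultilinearMap ℂ (fun _ : Fin 2 => C(I, ℂ)) ℂ :=
    (ContinuousMultilinearMap.mkPiAlgebraFin ℂ 2 ℂ).compContinuousLinearMap
      fun i => ContinuousMap.evalCLM ℂ (if i = 0 then (0 : I) else 1)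
  have h : (fun f : C(I, ℂ) => f 0 * f 1) = fun f => A fun _ => f := by
    ext f
    simp [A]
  rw [h]
  exact isContinuousPolynomial_apply_const _

theorem unitInterval.homeomorph_endpoints (φ : I ≃ₜ I) :
    (φ 0 = 0 ∧ φ 1 = 1) ∨ (φ 0 = 1 ∧ φ 1 = 0) := by
  obtain ⟨s, hs⟩ := φ.surjective 0
  obtain ⟨t, ht⟩ := φ.surjective 1
  rcases φ.continuous.strictMono_of_inj φ.injective with h | h
  · refine Or.inl ⟨le_antisymm ?_ unitInterval.nonneg', le_antisymm unitInterval.le_one' ?_⟩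
    · exact (h.monotone unitInterval.nonneg').trans_eq hs
    · exact ht.symm.trans_le (h.monotone unitInterval.le_one')
  · refine Or.inr ⟨le_antisymm unitInterval.le_one' ?_, le_antisymm ?_ unitInterval.nonneg'⟩
    · exact ht.symm.trans_le (h.antitone unitInterval.nonneg')
    · exact (h.antitone unitInterval.le_one').trans_eq hs

theorem isGroupInvariant_of_symmetric {p : ℂ → ℂ → ℂ} (hp : ∀ a b, p a b = p b a) :
    IsGroupInvariant (compositionGroup I) fun f : C(I, ℂ) => p (f 0) (f 1) := by
  rintro γ ⟨φ, hφ⟩ f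
  simp only [hφ, ContinuousMap.comp_apply]
  change p (f (φ 0)) (f (φ 1)) = _
  rcases unitInterval.homeomorph_endpoints φ with ⟨h0, h1⟩ | ⟨h0, h1⟩
  · rw [h0, h1]
  · rw [h0, h1, hp]

theorem separatesPointFromSet_of_norm_le {E F : Type*} [NormedAddCommGroup F] {P : E → F} {z : E}
    {K : Set E} {C : ℝ} (hC : 0 ≤ C)
    (hK : ∀ w ∈ K, ‖P w‖ ≤ C) (hz : C < ‖P z‖) :
    SeparatesPointFromSet P z K := by
  refine lt_of_le_of_lt (iSup₂_le fun w hw => ?_)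
    ((ENNReal.ofReal_lt_ofReal_iff_of_nonneg hC).2 hz |>.trans_eq (ofReal_norm _))
  rw [← ofReal_norm]
  exact ENNReal.ofReal_le_ofReal (hK w hw)

theorem exists_two_lt_norm_pow_add_pow {a b : ℂ} (ha : 1 < ‖a‖) (hab : ‖b‖ < ‖a‖) :
    ∃ n : ℕ, 2 < ‖a ^ n + b ^ n‖ := by
  have ha0 : 0 < ‖a‖ := one_pos.trans ha
  have h1 := (tendsto_pow_atTop_atTop_of_one_lt ha).eventually_gt_atTop 4
  have h2 := (tendsto_pow_atTop_nhds_zero_of_lt_one (r := ‖b‖ / ‖a‖) (by positivity)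
    ((div_lt_one ha0).2 hab)).eventually_lt_const (u := 1 / 2) (by norm_num)
  obtain ⟨n, hn1, hn2⟩ := (h1.and h2).exists
  refine ⟨n, ?_⟩
  rw [div_pow, div_lt_iff₀ (by positivity)] at hn2
  have h3 := norm_sub_le_norm_add (a ^ n) (b ^ n)
  rw [norm_pow, norm_pow] at h3
  linarith

theorem exists_norm_le_one_of_endpoints {a b : ℂ} (ha : ‖a‖ ≤ 1) (hb : ‖b‖ ≤ 1) :
    ∃ h : C(I, ℂ), h 0 = a ∧ h 1 = b ∧ ‖h‖ ≤ 1 := by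
  refine ⟨⟨fun t => AffineMap.lineMap a b (t : ℝ), by fun_prop⟩, by simp, by simp, ?_⟩
  rw [ContinuousMap.norm_le _ zero_le_one]
  intro t
  rw [← mem_closedBall_zero_iff] at *
  exact (convex_closedBall (0 : ℂ) 1).lineMap_mem ha hb t.2

theorem mainTheorem4 (g : C(I, ℂ)) (hg : g ∉ Metric.closedBall (0 : C(I, ℂ)) 1) :
    (∃ P : C(I, ℂ) → ℂ, IsContinuousPolynomial ℂ P ∧ IsGroupInvariant (compositionGroup I) P ∧
        SeparatesPointFromSet P g (Metric.closedBall (0 : C(I, ℂ)) 1)) ↔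
      1 < max ‖g 0‖ ‖g 1‖ := by
  constructor
  · rintro ⟨P, hP, hG, hsep⟩
    by_contra! hle
    obtain ⟨h, h0, h1, hh⟩ := exists_norm_le_one_of_endpoints
      ((le_max_left _ _).trans hle) ((le_max_right _ _).trans hle)
    have hPg : P g = P h := hP.apply_eq_of_eq_endpoints hG h0.symm h1.symm
    refine absurd hsep (not_lt.2 ?_)
    rw [hPg]
    exact le_iSup₂ (f := fun w (_ : w ∈ Metric.closedBall (0 : C(I, ℂ)) 1) => ‖P w‖ₑ) h
      (mem_closedBall_zero_iff.2 hh)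
  · intro hmax
    have hball : ∀ f ∈ Metric.closedBall (0 : C(I, ℂ)) 1, ∀ t, ‖f t‖ ≤ 1 := fun f hf t =>
      (f.norm_coe_le_norm t).trans (mem_closedBall_zero_iff.1 hf)
    -- With equal moduli the powers may cancel, so the product is used; otherwise the larger one
    -- dominates a high power sum.
    by_cases heq : ‖g 0‖ = ‖g 1‖
    · rw [← heq, max_self] at hmax
      refine ⟨_, isContinuousPolynomial_mul, isGroupInvariant_of_symmetric mul_comm,
        separatesPointFromSet_of_norm_le zero_le_one (fun f hf => ?_) ?_⟩
      · rw [norm_mul]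
        exact mul_le_one₀ (hball f hf 0) (norm_nonneg _) (hball f hf 1)
      · rw [norm_mul, ← heq]
        nlinarith
    · obtain ⟨n, hn⟩ : ∃ n : ℕ, 2 < ‖g 0 ^ n + g 1 ^ n‖ := by
        rcases lt_or_gt_of_ne heq with hlt | hlt
        · rw [max_eq_right hlt.le] at hmax
          simp_rw [add_comm (g 0 ^ _)]
          exact exists_two_lt_norm_pow_add_pow hmax hlt
        · rw [max_eq_left hlt.le] at hmax
          exact exists_two_lt_norm_pow_add_pow hmax hlt
      refine ⟨_, isContinuousPolynomial_pow_add_pow n,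
        isGroupInvariant_of_symmetric (p := fun a b => a ^ n + b ^ n) fun a b => add_comm _ _,
        separatesPointFromSet_of_norm_le zero_le_two (fun f hf => ?_) hn⟩
      refine (norm_add_le _ _).trans ?_
      rw [norm_pow, norm_pow]
      linarith [pow_le_one₀ (n := n) (norm_nonneg _) (hball f hf 0),
        pow_le_one₀ (n := n) (norm_nonneg _) (hball f hf 1)]
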